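/- Let $T$ be a finite tree. For a set $D$ of vertices of $T$ let $N[D]$ be the set of all vertices that lie in $D$ or are adjacent to a vertex of $D$. A $\gamma$-set of $T$ is a set $D\subseteq V(T)$ of minimum cardinality with $N[D]=V(T)$. Let $G=T(\gamma)$ be the $\gamma$-graph of $T$: its vertices are the $\gamma$-sets of $T$, and two $\gamma$-sets $D_1,D_2$ are adjacent if $D_2=(D_1\setminus\{u\})\cup\{v\}$ for some $u\in D_1$, $v\in D_2$ with $uv\in E(T)$. For a $\gamma$-set $D$ and $x\in D$, a $D$-external private neighbour of $x$ is a vertex $y\neq x$ with $y\in N[\{x\}]\setminus N[D\setminus\{x\}]$. A leaf is a vertex of degree one, and a stem is a vertex adjacent to a leaf. A Cartesian product graph is a graph isomorphic to the Cartesian product $G_1\mathbin{\square}G_2$ of two graphs, each with at least two vertices. Let $S$ be a stem of $G$, let $L_1,\dots,L_k$ be all the leaves of $G$ adjacent to $S$, and let $G'=G-\{L_1,\dots,L_k\}$. If $\deg_{G'}(S)\ge 3$, then $G'$ is a Cartesian product graph if and only if every vertex $x\in S$ (a vertex of $T$) has an $S$-external private neighbour. -/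

import Mathlib

open scoped SimpleGraph

universe u

namespace GammaGraph

/-- The closed neighbourhood `N[v]` of a vertex. -/
def closedNbhd {V : Type u} (G : SimpleGraph V) (v : V) : Set V :=
  {w | w = v ∨ G.Adj v w}

/-- The closed neighbourhood `N[D]` of a set of vertices. -/
def closedNbhdSet {V : Type u} (G : SimpleGraph V) (D : Finset V) : Set V :=
  {w | ∃ v ∈ D, w ∈ closedNbhd G v}

/-- `D` is a dominating set: `N[D]` is the whole vertex set. -/
def IsDominating {V : Type u} (G : SimpleGraph V) (D : Finset V) : Prop :=
  closedNbhdSet G D = Set.univ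

/-- A `γ`-set: a dominating set of minimum cardinality. -/
def IsGammaSet {V : Type u} (G : SimpleGraph V) (D : Finset V) : Prop :=
  IsDominating G D ∧ ∀ E : Finset V, IsDominating G E → D.card ≤ E.card

/-- The private neighbours `pn(x, D) = N[x] - N[D - x]` of `x` with respect to `D`. -/
def privateNbrs {V : Type u} [DecidableEq V] (G : SimpleGraph V) (x : V) (D : Finset V) :
    Set V :=
  closedNbhd G x \ closedNbhdSet G (D.erase x)

/-- `y` is a `D`-external private neighbour of `x`. -/
def IsExternalPrivateNbr {V : Type u} [DecidableEq V] (G : SimpleGraph V) (D : Finset V)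
    (x y : V) : Prop :=
  y ≠ x ∧ y ∈ privateNbrs G x D

/-- The `γ`-graph of `G`: the vertices are the `γ`-sets of `G`, and `D₁`, `D₂` are adjacent when
`D₂ = (D₁ - {a}) ∪ {b}` for some `a ∈ D₁` and `b ∈ D₂` that are adjacent in `G`. -/
def gammaGraph {V : Type u} [DecidableEq V] (G : SimpleGraph V) :
    SimpleGraph {D : Finset V // IsGammaSet G D} where
  Adj D₁ D₂ := ∃ a ∈ D₁.1, ∃ b ∈ D₂.1, D₂.1 = insert b (D₁.1.erase a) ∧ G.Adj a b
  symm := ⟨by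
    rintro ⟨D₁, h₁⟩ ⟨D₂, h₂⟩ ⟨a, ha, b, hb, h, hab⟩
    dsimp only at ha hb h
    have hbD : b ∉ D₁ := by
      intro hbD
      have hb' : b ∈ D₁.erase a := Finset.mem_erase.2 ⟨hab.ne', hbD⟩
      rw [Finset.insert_eq_of_mem hb'] at h
      have hle := h₁.2 D₂ h₂.1
      have hlt := Finset.card_erase_lt_of_mem ha
      rw [h] at hle
      omega
    refine ⟨b, hb, a, ha, ?_, hab.symm⟩
    dsimp only
    have hb' : b ∉ D₁.erase a := fun hmem => hbD (Finset.mem_of_mem_erase hmem)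
    rw [h, Finset.erase_insert hb', Finset.insert_erase ha]⟩
  loopless := ⟨by
    rintro ⟨D, hD⟩ ⟨a, ha, b, hb, h, hab⟩
    dsimp only at ha hb h
    have ha' : a ∈ insert b (D.erase a) := h ▸ ha
    rcases Finset.mem_insert.1 ha' with hEq | hmem
    · exact hab.ne hEq
    · exact Finset.notMem_erase a D hmem⟩

/-- A leaf: a vertex of degree one. -/
def IsLeaf {W : Type u} (G : SimpleGraph W) (v : W) : Prop :=
  (G.neighborSet v).ncard = 1

/-- The leaves at `v`: the neighbours of `v` that are leaves. -/
def leavesAt {W : Type u} (G : SimpleGraph W) (v : W) : Set W :=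
  {w | G.Adj v w ∧ IsLeaf G w}

/-- A stem: a vertex adjacent to a leaf. -/
def IsStem {W : Type u} (G : SimpleGraph W) (v : W) : Prop :=
  (leavesAt G v).Nonempty

/-- `G` with the leaves at `v` deleted. -/
def deleteLeavesAt {W : Type u} (G : SimpleGraph W) (v : W) :
    SimpleGraph ((leavesAt G v)ᶜ : Set W) :=
  G.induce (leavesAt G v)ᶜ

theorem self_mem_compl_leavesAt {W : Type u} (G : SimpleGraph W) (v : W) :
    v ∈ (leavesAt G v)ᶜ :=
  fun h => G.irrefl h.1

/-- A Cartesian product graph: isomorphic to the Cartesian product of two graphs of order at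
least two. -/
def IsCartesianProductGraph {W : Type u} (G : SimpleGraph W) : Prop :=
  ∃ (A B : Type u) (G₁ : SimpleGraph A) (G₂ : SimpleGraph B),
    Nontrivial A ∧ Nontrivial B ∧ Nonempty (G ≃g (G₁ □ G₂))

end GammaGraph

/-! A `γ`-set is a placement of tokens on the tree, and an edge of the `γ`-graph moves one token
along an edge. A leaf `L` at `S` arises by moving some `u` to `v`. Since every move out of `L` leads
back to `S`, each `x ≠ u` that can move in `S` shares with `u` a neighbour `w` that these two alone
dominate in `S` (`exists_blocking_nbr`).

Suppose every element of `S` has an external private neighbour; then each has at most one target.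
Connectivity of slides confined to a region (`slideIn_connected`) shows that `L` is the only `γ`-set
without `u` (`mem_or_eq_leaf`), so the graph left after deleting the leaves consists of the `γ`-sets
containing `u`. While `u` stays, the branches at `u` do not interact, and mixing two sets along a
union of branches turns this graph into a product (`isCartesianProductGraph_of_band`). Two nonleaf
neighbours of `S` move elements of different branches, so both factors are nontrivial.

Conversely, an element without external private neighbour must be `u` (`eq_of_no_external`), and
degree three yields two nonleaf moves of `u`, to `p ≠ q`. In a product, two edges at a vertex span a
square, or some third edge spans a square with each of them. Two moves of `u` never span a square
(`eq_of_common_slide_same`), and a move of `x ≠ u` does so only with the move of `u` to the common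
neighbour `w` of `u` and `x` (`eq_of_common_slide`), which cannot be both `p` and `q`. -/

namespace GammaGraph

/-! ### Parents, short cycles and branches in a tree. -/

section Tree

variable {V : Type u} {T : SimpleGraph V}

/-- Uniqueness of the parent in the tree rooted at `r`: shortest walks to `b` and to `c` both extend
to paths from `r` to `a`, and there is only one. -/
theorem eq_of_adj_of_dist_lt (hT : T.IsTree) (r : V) {a b c : V} (hab : T.Adj a b)
    (hac : T.Adj a c) (hb : T.dist r b < T.dist r a) (hc : T.dist r c < T.dist r a) : b = c := by
  have key : ∀ d, T.Adj a d → T.dist r d < T.dist r a →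
      ∃ p : T.Walk r a, p.IsPath ∧ p.penultimate = d := by
    intro d had hd
    obtain ⟨p, -, hp⟩ := hT.connected.exists_path_of_dist r d
    refine ⟨p.concat had.symm, SimpleGraph.Walk.isPath_of_length_eq_dist _ ?_, by simp⟩
    rcases hT.dist_eq_dist_add_one_of_adj r had with h | h
    · simp [hp, h]
    · omega
  obtain ⟨p, hp, rfl⟩ := key b hab hb
  obtain ⟨q, hq, rfl⟩ := key c hac hc
  rw [(hT.existsUnique_path r a).unique hp hq]

theorem no_triangle (hT : T.IsTree) {a b c : V} (hab : T.Adj a b) (hbc : T.Adj b c)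
    (hac : T.Adj a c) : False := by
  have h1 := hT.dist_ne_of_adj a hbc
  have h2 := (SimpleGraph.dist_eq_one_iff_adj (G := T)).2 hab
  have h3 := (SimpleGraph.dist_eq_one_iff_adj (G := T)).2 hac
  omega

theorem eq_of_common_nbr (hT : T.IsTree) {a b c d : V} (hac : a ≠ c) (hab : T.Adj a b)
    (hcb : T.Adj c b) (had : T.Adj a d) (hcd : T.Adj c d) : b = d := by
  have hb := (SimpleGraph.dist_eq_one_iff_adj (G := T)).2 hab
  have hd := (SimpleGraph.dist_eq_one_iff_adj (G := T)).2 had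
  have h1 := hT.dist_ne_of_adj a hcb
  have h2 : T.dist a c ≠ 0 := fun h => hac (hT.connected.dist_eq_zero_iff.1 h)
  exact eq_of_adj_of_dist_lt hT a hcb hcd (by omega) (by omega)

/-- The component containing `w` of the graph obtained by deleting the vertex `z`. -/
def branch (T : SimpleGraph V) (z w : V) : Set V :=
  {t | Relation.ReflTransGen (fun a b => T.Adj a b ∧ b ≠ z) w t}

/-- `P` is a union of components of the graph obtained by deleting the vertex `z`. -/
def IsBranchUnion (T : SimpleGraph V) (z : V) (P : Set V) : Prop :=
  z ∉ P ∧ ∀ a ∈ P, ∀ b ∉ P, T.Adj a b → b = z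

theorem isBranchUnion_branch {z w : V} (h : w ≠ z) : IsBranchUnion T z (branch T z w) := by
  refine ⟨fun hz => ?_, fun a ha b hb hab => ?_⟩
  · rcases Relation.ReflTransGen.cases_tail hz with h' | ⟨c, -, hc⟩
    · exact h h'.symm
    · exact hc.2 rfl
  · by_contra hbz
    exact hb (Relation.ReflTransGen.tail ha ⟨hab, hbz⟩)

theorem IsBranchUnion.compl {z : V} {P : Set V} (h : IsBranchUnion T z P) :
    IsBranchUnion T z {t | t ∉ P ∧ t ≠ z} := by
  refine ⟨fun hz => hz.2 rfl, fun a ha b hb hab => ?_⟩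
  by_contra hbz
  have hbP : b ∈ P := by
    by_contra hbP
    exact hb ⟨hbP, hbz⟩
  exact ha.2 (h.2 b hbP a ha.1 hab.symm)

theorem IsBranchUnion.mem_iff_of_adj {P : Set V} {z a b : V} (hP : IsBranchUnion T z P)
    (hab : T.Adj a b) (ha : a ≠ z) (hb : b ≠ z) : a ∈ P ↔ b ∈ P := by
  constructor
  · intro h
    by_contra h'
    exact hb (hP.2 a h b h' hab)
  · intro h
    by_contra h'
    exact ha (hP.2 b h a h' hab.symm)

/-- The edge `zn` is a bridge, while a walk from `w` to `n` avoiding `z` would join `z` to `n`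
without it. -/
theorem notMem_branch (hT : T.IsTree) {z w n : V} (hw : T.Adj z w) (hn : T.Adj z n)
    (hwn : w ≠ n) : n ∉ branch T z w := by
  intro hmem
  have hbr := (SimpleGraph.isAcyclic_iff_forall_adj_isBridge.1 hT.isAcyclic) hn
  rw [SimpleGraph.isBridge_iff] at hbr
  apply hbr
  have hstep : ∀ t, Relation.ReflTransGen (fun a b => T.Adj a b ∧ b ≠ z) w t →
      t ≠ z ∧ (T \ SimpleGraph.fromEdgeSet {s(z, n)}).Reachable z t := by
    intro t ht
    induction ht with
    | refl =>
      refine ⟨hw.ne', SimpleGraph.Adj.reachable ?_⟩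
      have := hw.ne'
      simp [hw, hwn, this]
    | tail _ hbc ih =>
      refine ⟨hbc.2, ih.2.trans (SimpleGraph.Adj.reachable ?_)⟩
      simp [hbc.1, hbc.2, ih.1]
  exact (hstep n hmem).2

end Tree

/-! ### Slides between `γ`-sets and private neighbours. -/

section Slide

variable {V : Type u} {T : SimpleGraph V}

/-- `w` lies in the closed neighbourhood of `v`. -/
def Dominates (T : SimpleGraph V) (v w : V) : Prop := w = v ∨ T.Adj v w

theorem isDominating_iff {D : Finset V} :
    IsDominating T D ↔ ∀ t, ∃ d ∈ D, Dominates T d t := by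
  simp only [IsDominating, closedNbhdSet, closedNbhd, Set.eq_univ_iff_forall]
  rfl

/-- `E` arises from `D` by moving one element along an edge. -/
def Slide (T : SimpleGraph V) (a b : V) (D E : Finset V) : Prop :=
  a ∈ D ∧ b ∉ D ∧ a ∉ E ∧ b ∈ E ∧ T.Adj a b ∧ ∀ t, t ≠ a → t ≠ b → (t ∈ D ↔ t ∈ E)

theorem Slide.symm {a b : V} {D E : Finset V} (h : Slide T a b D E) : Slide T b a E D := by
  obtain ⟨h1, h2, h3, h4, h5, h6⟩ := h
  exact ⟨h4, h3, h2, h1, h5.symm, fun t ht ht' => (h6 t ht' ht).symm⟩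

theorem isGammaSet_of_card_le {D E : Finset V} (hD : IsGammaSet T D) (hE : IsDominating T E)
    (h : E.card ≤ D.card) : IsGammaSet T E :=
  ⟨hE, fun F hF => h.trans (hD.2 F hF)⟩

theorem Slide.mem_iff {a b : V} {D E : Finset V} (h : Slide T a b D E) (t : V) :
    t ∈ E ↔ t = b ∨ t ∈ D ∧ t ≠ a := by
  obtain ⟨h1, h2, h3, h4, h5, h6⟩ := h
  have := h6 t
  grind

variable [DecidableEq V]

theorem isGammaSet_insert_erase {D : Finset V} (hD : IsGammaSet T D) {a b : V} (ha : a ∈ D)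
    (h : IsDominating T (insert b (D.erase a))) : IsGammaSet T (insert b (D.erase a)) := by
  refine isGammaSet_of_card_le hD h ?_
  have h1 := Finset.card_insert_le b (D.erase a)
  have h2 := Finset.card_erase_add_one ha
  omega

theorem slide_insert_erase {D : Finset V} (hD : IsGammaSet T D) {a b : V} (ha : a ∈ D)
    (hab : T.Adj a b) (h : IsDominating T (insert b (D.erase a))) :
    Slide T a b D (insert b (D.erase a)) := by
  have hb : b ∉ D := by
    intro hb
    have h1 := hD.2 _ h
    rw [Finset.insert_eq_of_mem (Finset.mem_erase.2 ⟨hab.ne', hb⟩)] at h1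
    have h2 := Finset.card_erase_add_one ha
    omega
  have := hab.ne
  refine ⟨ha, hb, ?_, ?_, hab, ?_⟩ <;> grind

theorem Slide.eq {a b : V} {D E : Finset V} (h : Slide T a b D E) :
    E = insert b (D.erase a) := by
  obtain ⟨h1, h2, h3, h4, h5, h6⟩ := h
  ext t
  have := h6 t
  grind

theorem gammaGraph_adj_iff {D E : {D : Finset V // IsGammaSet T D}} :
    (gammaGraph T).Adj D E ↔ ∃ a b, Slide T a b D.1 E.1 := by
  constructor
  · rintro ⟨a, ha, b, hb, h, hab⟩
    refine ⟨a, b, ?_⟩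
    rw [h]
    exact slide_insert_erase D.2 ha hab (h ▸ E.2.1)
  · rintro ⟨a, b, h⟩
    exact ⟨a, h.1, b, h.2.2.2.1, h.eq, h.2.2.2.2.1⟩

theorem IsGammaSet.exists_private {D : Finset V} (hD : IsGammaSet T D) {z : V} (hz : z ∈ D) :
    ∃ y, Dominates T z y ∧ ∀ d ∈ D, Dominates T d y → d = z := by
  have h : ¬ IsDominating T (D.erase z) := by
    intro h
    have h1 := hD.2 _ h
    have h2 := Finset.card_erase_add_one hz
    omega
  rw [isDominating_iff] at h
  push Not at h
  obtain ⟨y, hy⟩ := h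
  obtain ⟨d, hd, hdy⟩ := isDominating_iff.1 hD.1 y
  have hall : ∀ d ∈ D, Dominates T d y → d = z := by
    intro d hd hdy
    by_contra hne
    exact hy d (Finset.mem_erase.2 ⟨hne, hd⟩) hdy
  exact ⟨y, hall d hd hdy ▸ hdy, hall⟩

end Slide

/-! ### Connectivity of slides confined to a region. -/

section Connectivity

variable {V : Type u} [DecidableEq V] {T : SimpleGraph V}

/-- No element of `M` in `B` can slide within `B` towards the root `r`. -/
def IsStuck (T : SimpleGraph V) (r : V) (B : Set V) (M : Finset V) : Prop :=
  ∀ z ∈ M, z ∈ B → ∀ p ∈ B, T.Adj z p → T.dist r p < T.dist r z →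
    ¬ IsDominating T (insert p (M.erase z))

/-- Some vertex private to `z`, equal to `z` or a child of it, keeps `z` from being dispensable or
moved up; `M'`, lacking `z`, has to dominate that vertex from deeper down. -/
theorem IsStuck.exists_deeper (hT : T.IsTree) (r : V) {B : Set V} {M M' : Finset V}
    (hM : IsGammaSet T M) (hM' : IsGammaSet T M') (hK : ∀ t ∉ B, ∃ k ∈ M, k ∉ B ∧ Dominates T k t)
    (hMM' : ∀ t ∉ B, (t ∈ M ↔ t ∈ M')) (hs : IsStuck T r B M) {z : V} (hz : z ∈ M)
    (hz' : z ∉ M') : ∃ e ∈ M', e ∉ M ∧ T.dist r z < T.dist r e := by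
  have hzB : z ∈ B := by
    by_contra h
    exact hz' ((hMM' z h).1 hz)
  by_cases hp : ∃ p ∈ B, T.Adj z p ∧ T.dist r p < T.dist r z
  · obtain ⟨p, hpB, hzp, hlt⟩ := hp
    -- The vertex `y` left undominated is private to `z`. The parent `p` misses it, so it is a child
    -- of `z`.
    have hnd := hs z hz hzB p hpB hzp hlt
    rw [isDominating_iff] at hnd
    push Not at hnd
    obtain ⟨y, hy⟩ := hnd
    obtain ⟨d, hd, hdy⟩ := isDominating_iff.1 hM.1 y
    have hall : ∀ d ∈ M, Dominates T d y → d = z := by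
      intro d hd hdy
      by_contra hne
      exact hy d (by simp [hne, hd]) hdy
    have hzy := hall d hd hdy ▸ hdy
    have hpy := hy p (by simp)
    have hne : y ≠ z := by
      rintro rfl
      exact hpy (Or.inr hzp.symm)
    have hadj : T.Adj z y := hzy.resolve_left hne
    have hdeep : T.dist r z < T.dist r y := by
      have := hT.dist_ne_of_adj r hadj
      by_contra hcon
      exact hpy (Or.inl (eq_of_adj_of_dist_lt hT r hadj hzp (by omega) hlt))
    obtain ⟨e, he, hey⟩ := isDominating_iff.1 hM'.1 y
    have hez : e ≠ z := by
      rintro rfl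
      exact hz' he
    refine ⟨e, he, fun heM => hez (hall e heM hey), ?_⟩
    rcases hey with rfl | hey
    · exact hdeep
    · by_contra hcon
      exact hez (eq_of_adj_of_dist_lt hT r hey.symm hadj.symm (by omega) (by omega))
  -- With no parent of `z` in `B`, any private neighbour `y` is `z` itself or a child, because `hK`
  -- forces `y` into `B`.
  · push Not at hp
    obtain ⟨y, hzy, hall⟩ := hM.exists_private hz
    have hyB : y ∈ B := by
      by_contra hyB
      obtain ⟨k, hk, hkB, hky⟩ := hK y hyB
      exact hkB (hall k hk hky ▸ hzB)
    obtain ⟨e, he, hey⟩ := isDominating_iff.1 hM'.1 y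
    have hez : e ≠ z := by
      rintro rfl
      exact hz' he
    have heM : e ∉ M := fun heM => hez (hall e heM hey)
    have heB : e ∈ B := by
      by_contra heB
      exact heM ((hMM' e heB).2 he)
    refine ⟨e, he, heM, ?_⟩
    rcases hzy with rfl | hzy
    · have hadj := hey.resolve_left hez.symm
      have h1 := hp e heB hadj.symm
      have h2 := hT.dist_ne_of_adj r hadj
      omega
    · have h1 := hp y hyB hzy
      have h2 := hT.dist_ne_of_adj r hzy
      rcases hey with rfl | hey
      · omega
      · by_contra hcon
        exact hez (eq_of_adj_of_dist_lt hT r hey.symm hzy.symm (by omega) (by omega))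

/-- A deepest element of the symmetric difference contradicts `IsStuck.exists_deeper`. Applied both
ways, this makes the stuck set a normal form. -/
theorem IsStuck.subset (hT : T.IsTree) (r : V) {B : Set V} {M M' : Finset V}
    (hM : IsGammaSet T M) (hM' : IsGammaSet T M') (hK : ∀ t ∉ B, ∃ k ∈ M, k ∉ B ∧ Dominates T k t)
    (hMM' : ∀ t ∉ B, (t ∈ M ↔ t ∈ M')) (hs : IsStuck T r B M) (hs' : IsStuck T r B M') :
    M ⊆ M' := by
  have hK' : ∀ t ∉ B, ∃ k ∈ M', k ∉ B ∧ Dominates T k t := by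
    intro t ht
    obtain ⟨k, hk, hkB, hkt⟩ := hK t ht
    exact ⟨k, (hMM' k hkB).1 hk, hkB, hkt⟩
  by_contra hsub
  obtain ⟨z₀, hz₀, hz₀'⟩ := Finset.not_subset.1 hsub
  obtain ⟨z, hz, hmax⟩ := Finset.exists_max_image (symmDiff M M') (T.dist r)
    ⟨z₀, Finset.mem_symmDiff.2 (Or.inl ⟨hz₀, hz₀'⟩)⟩
  rcases Finset.mem_symmDiff.1 hz with ⟨h1, h2⟩ | ⟨h1, h2⟩
  · obtain ⟨e, he, he', hlt⟩ := hs.exists_deeper hT r hM hM' hK hMM' h1 h2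
    have := hmax e (Finset.mem_symmDiff.2 (Or.inr ⟨he, he'⟩))
    omega
  · obtain ⟨e, he, he', hlt⟩ := hs'.exists_deeper hT r hM' hM hK'
      (fun t ht => (hMM' t ht).symm) h1 h2
    have := hmax e (Finset.mem_symmDiff.2 (Or.inl ⟨he, he'⟩))
    omega

/-- The slides between `γ`-sets that take place inside `B`. -/
def SlideIn (T : SimpleGraph V) (B : Set V) (D E : {D : Finset V // IsGammaSet T D}) : Prop :=
  (gammaGraph T).Adj D E ∧ ∀ t ∉ B, (t ∈ D.1 ↔ t ∈ E.1)

theorem SlideIn.symm {B : Set V} {D E : {D : Finset V // IsGammaSet T D}} (h : SlideIn T B D E) :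
    SlideIn T B E D :=
  ⟨h.1.symm, fun t ht => (h.2 t ht).symm⟩

theorem agree_of_slideIn {B : Set V} {D E : {D : Finset V // IsGammaSet T D}}
    (h : Relation.ReflTransGen (SlideIn T B) D E) : ∀ t ∉ B, (t ∈ D.1 ↔ t ∈ E.1) := by
  induction h with
  | refl => simp
  | tail _ hbc ih => exact fun t ht => (ih t ht).trans (hbc.2 t ht)

/-- Each slide towards `r` lowers the sum of the distances to `r`, so sliding terminates. -/
theorem exists_isStuck (r : V) (B : Set V) (F : {D : Finset V // IsGammaSet T D}) :
    ∃ M, IsStuck T r B M.1 ∧ Relation.ReflTransGen (SlideIn T B) F M := by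
  induction hn : ∑ z ∈ F.1, T.dist r z using Nat.strong_induction_on generalizing F with
  | _ n ih =>
    by_cases hs : IsStuck T r B F.1
    · exact ⟨F, hs, Relation.ReflTransGen.refl⟩
    · unfold IsStuck at hs
      push Not at hs
      obtain ⟨z, hz, hzB, p, hpB, hzp, hlt, hdom⟩ := hs
      have hsl := slide_insert_erase F.2 hz hzp hdom
      obtain ⟨M, hM, hFM⟩ := ih _ (by
        rw [Finset.sum_insert (fun h => hsl.2.1 (Finset.mem_of_mem_erase h)), ← hn,
          ← Finset.add_sum_erase _ _ hz]
        omega) ⟨_, isGammaSet_insert_erase F.2 hz hdom⟩ rfl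
      refine ⟨M, hM, Relation.ReflTransGen.head ⟨gammaGraph_adj_iff.2 ⟨z, p, hsl⟩, ?_⟩ hFM⟩
      intro t ht
      exact hsl.2.2.2.2.2 t (fun h => ht (h ▸ hzB)) (fun h => ht (h ▸ hpB))

/-- Two `γ`-sets of a tree that agree outside `B`, and there dominate everything outside `B`, are
joined by slides inside `B`. -/
theorem slideIn_connected (hT : T.IsTree) {B : Set V} {D E : {D : Finset V // IsGammaSet T D}}
    (hDE : ∀ t ∉ B, (t ∈ D.1 ↔ t ∈ E.1)) (hK : ∀ t ∉ B, ∃ k ∈ D.1, k ∉ B ∧ Dominates T k t) :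
    Relation.ReflTransGen (SlideIn T B) D E := by
  obtain ⟨r⟩ := hT.connected.nonempty
  obtain ⟨M, hM, hDM⟩ := exists_isStuck r B D
  obtain ⟨N, hN, hEN⟩ := exists_isStuck r B E
  have h1 := agree_of_slideIn hDM
  have h2 := agree_of_slideIn hEN
  have hMN : ∀ t ∉ B, (t ∈ M.1 ↔ t ∈ N.1) := fun t ht =>
    (h1 t ht).symm.trans ((hDE t ht).trans (h2 t ht))
  have hKM : ∀ t ∉ B, ∃ k ∈ M.1, k ∉ B ∧ Dominates T k t := by
    intro t ht
    obtain ⟨k, hk, hkB, hkt⟩ := hK t ht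
    exact ⟨k, (h1 k hkB).1 hk, hkB, hkt⟩
  have hKN : ∀ t ∉ B, ∃ k ∈ N.1, k ∉ B ∧ Dominates T k t := by
    intro t ht
    obtain ⟨k, hk, hkB, hkt⟩ := hKM t ht
    exact ⟨k, (hMN k hkB).1 hk, hkB, hkt⟩
  have hEq : M = N := Subtype.ext (Finset.Subset.antisymm
    (hM.subset hT r M.2 N.2 hKM hMN hN)
    (hN.subset hT r N.2 M.2 hKN (fun t ht => (hMN t ht).symm) hM))
  subst hEq
  have : Std.Symm (SlideIn T B) := ⟨fun _ _ h => h.symm⟩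
  exact hDM.trans (Relation.ReflTransGen.stdSymm.symm _ _ hEN)

theorem exists_slideIn (hT : T.IsTree) {B : Set V} {D E : {D : Finset V // IsGammaSet T D}}
    (hne : D ≠ E) (hDE : ∀ t ∉ B, (t ∈ D.1 ↔ t ∈ E.1))
    (hK : ∀ t ∉ B, ∃ k ∈ D.1, k ∉ B ∧ Dominates T k t) : ∃ F, SlideIn T B D F := by
  rcases Relation.ReflTransGen.cases_head (slideIn_connected hT hDE hK) with h | ⟨F, hF, -⟩
  · exact absurd h hne
  · exact ⟨F, hF⟩

theorem gammaGraph_preconnected (hT : T.IsTree) : (gammaGraph T).Preconnected := by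
  intro D E
  have h := slideIn_connected hT (B := Set.univ) (D := D) (E := E) (by simp) (by simp)
  rw [SimpleGraph.reachable_iff_reflTransGen]
  exact Relation.ReflTransGen.mono (fun _ _ h => h.1) _ _ h

end Connectivity

/-! ### Squares in Cartesian products, and a criterion for being a product. -/

section Product

variable {W : Type u} {G : SimpleGraph W}

theorem eq_of_adj_isLeaf {s l t : W} (hl : l ∈ leavesAt G s) (ht : G.Adj l t) : t = s := by
  obtain ⟨x, hx⟩ := Set.ncard_eq_one.1 hl.2
  have h1 : t ∈ G.neighborSet l := ht
  have h2 : s ∈ G.neighborSet l := hl.1.symm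
  rw [hx] at h1 h2
  exact h1.trans h2.symm

/-- A walk from `s` that enters a leaf at `s` can only return to `s`, so the detour can be dropped.
-/
theorem deleteLeavesAt_connected (hG : G.Preconnected) (s : W) :
    (deleteLeavesAt G s).Connected := by
  set s' : ((leavesAt G s)ᶜ : Set W) := ⟨s, self_mem_compl_leavesAt G s⟩
  have key : ∀ t, Relation.ReflTransGen G.Adj s t → ∀ ht : t ∈ (leavesAt G s)ᶜ,
      (deleteLeavesAt G s).Reachable s' ⟨t, ht⟩ := by
    intro t h
    induction h with
    | refl => exact fun _ => SimpleGraph.Reachable.refl _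
    | @tail b c _ hbc ih =>
      intro hc
      by_cases hb : b ∈ leavesAt G s
      · obtain rfl := eq_of_adj_isLeaf hb hbc
        exact SimpleGraph.Reachable.refl _
      · exact (ih hb).trans (SimpleGraph.Adj.reachable (by simpa [deleteLeavesAt] using hbc))
  have : Nonempty ((leavesAt G s)ᶜ : Set W) := ⟨s'⟩
  have hs : ∀ t, (deleteLeavesAt G s).Reachable s' t := fun t =>
    key t.1 ((SimpleGraph.reachable_iff_reflTransGen _ _).1 (hG s t.1)) t.2
  exact ⟨fun a b => (hs a).symm.trans (hs b)⟩

/-- Edges in different coordinates complete a square; for two edges in the same coordinate, an edge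
in the other one serves as `x`. -/
theorem exists_common_nbr_of_boxProd {A B : Type u} {G₁ : SimpleGraph A} {G₂ : SimpleGraph B}
    [Nontrivial A] [Nontrivial B] (h : (G₁ □ G₂).Connected) {s p q : A × B}
    (hp : (G₁ □ G₂).Adj s p) (hq : (G₁ □ G₂).Adj s q) :
    (∃ f, f ≠ s ∧ (G₁ □ G₂).Adj p f ∧ (G₁ □ G₂).Adj q f) ∨
      ∃ x, x ≠ p ∧ x ≠ q ∧ (G₁ □ G₂).Adj s x ∧
        (∃ f, f ≠ s ∧ (G₁ □ G₂).Adj x f ∧ (G₁ □ G₂).Adj p f) ∧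
        ∃ f, f ≠ s ∧ (G₁ □ G₂).Adj x f ∧ (G₁ □ G₂).Adj q f := by
  obtain ⟨s₁, s₂⟩ := s
  obtain ⟨p₁, p₂⟩ := p
  obtain ⟨q₁, q₂⟩ := q
  obtain ⟨x₁, hx₁⟩ := h.ofBoxProdLeft.preconnected.exists_adj_of_nontrivial s₁
  obtain ⟨x₂, hx₂⟩ := h.ofBoxProdRight.preconnected.exists_adj_of_nontrivial s₂
  simp only [SimpleGraph.boxProd_adj] at hp hq ⊢
  rcases hp with ⟨hp, rfl⟩ | ⟨hp, rfl⟩ <;> rcases hq with ⟨hq, rfl⟩ | ⟨hq, rfl⟩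
  · right
    refine ⟨(s₁, x₂), ?_, ?_, ?_, ⟨(p₁, x₂), ?_, ?_, ?_⟩, (q₁, x₂), ?_, ?_, ?_⟩ <;>
      simp [hp, hq, hx₂, hx₂.ne', hp.ne', hq.ne']
  · left
    refine ⟨(p₁, q₂), ?_, ?_, ?_⟩ <;> simp [hp, hq, hp.ne']
  · left
    refine ⟨(q₁, p₂), ?_, ?_, ?_⟩ <;> simp [hp, hq, hq.ne']
  · right
    refine ⟨(x₁, s₂), ?_, ?_, ?_, ⟨(x₁, p₂), ?_, ?_, ?_⟩, (x₁, q₂), ?_, ?_, ?_⟩ <;>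
      simp [hp, hq, hx₁, hx₁.ne', hp.ne', hq.ne']

theorem exists_common_nbr_of_isCartesianProductGraph (hG : G.Connected)
    (h : IsCartesianProductGraph G) {s p q : W} (hp : G.Adj s p) (hq : G.Adj s q) :
    (∃ f, f ≠ s ∧ G.Adj p f ∧ G.Adj q f) ∨
      ∃ x, x ≠ p ∧ x ≠ q ∧ G.Adj s x ∧ (∃ f, f ≠ s ∧ G.Adj x f ∧ G.Adj p f) ∧
        ∃ f, f ≠ s ∧ G.Adj x f ∧ G.Adj q f := by
  obtain ⟨A, B, G₁, G₂, hA, hB, ⟨φ⟩⟩ := h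
  have hc := (SimpleGraph.Iso.connected_iff φ).1 hG
  have back : ∀ x f, f ≠ φ s → (G₁ □ G₂).Adj (φ x) f → φ.symm f ≠ s ∧ G.Adj x (φ.symm f) := by
    intro x f hf hxf
    refine ⟨?_, ?_⟩
    · rintro rfl
      simp at hf
    · rw [← φ.map_adj_iff]
      simpa using hxf
  rcases exists_common_nbr_of_boxProd hc (φ.map_adj_iff.2 hp) (φ.map_adj_iff.2 hq) with
    ⟨f, hf, h1, h2⟩ | ⟨x, hxp, hxq, hsx, ⟨f, hf, h1, h2⟩, g, hg, h3, h4⟩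
  · exact Or.inl ⟨φ.symm f, (back p f hf h1).1, (back p f hf h1).2, (back q f hf h2).2⟩
  · obtain ⟨x, rfl⟩ := φ.surjective x
    refine Or.inr ⟨x, fun h => hxp (h ▸ rfl), fun h => hxq (h ▸ rfl), φ.map_adj_iff.1 hsx,
      ⟨φ.symm f, (back x f hf h1).1, (back x f hf h1).2, (back p f hf h2).2⟩,
      ⟨φ.symm g, (back x g hg h3).1, (back x g hg h3).2, (back q g hg h4).2⟩⟩

/-- A graph whose vertices form a rectangular band compatible with adjacency is a product. -/
theorem isCartesianProductGraph_of_band (mix : W → W → W) (s : W)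
    (hidem : ∀ a, mix a a = a) (hl : ∀ a b c, mix (mix a b) c = mix a c)
    (hr : ∀ a b c, mix a (mix b c) = mix a c)
    (hadj : ∀ a b, G.Adj a b ↔ (G.Adj (mix a s) (mix b s) ∧ mix s a = mix s b) ∨
      (G.Adj (mix s a) (mix s b) ∧ mix a s = mix b s))
    (h₁ : ∃ a, mix a s ≠ s) (h₂ : ∃ a, mix s a ≠ s) : IsCartesianProductGraph G := by
  -- The factors are the two fibres of the band through `s`, and mixing the two coordinates recovers
  -- the vertex.
  refine ⟨Set.range (mix · s), Set.range (mix s ·), G.induce _, G.induce _, ?_, ?_, ⟨?_⟩⟩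
  · obtain ⟨a, ha⟩ := h₁
    exact ⟨⟨_, a, rfl⟩, ⟨s, s, hidem s⟩, fun h => ha (congrArg Subtype.val h)⟩
  · obtain ⟨a, ha⟩ := h₂
    exact ⟨⟨_, a, rfl⟩, ⟨s, s, hidem s⟩, fun h => ha (congrArg Subtype.val h)⟩
  · refine ⟨⟨fun a => (⟨mix a s, a, rfl⟩, ⟨mix s a, a, rfl⟩), fun p => mix p.1.1 p.2.1, ?_, ?_⟩, ?_⟩
    · intro a
      simp only [hl, hr, hidem]
    · rintro ⟨⟨_, a, rfl⟩, ⟨_, b, rfl⟩⟩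
      simp only [hl, hr]
    · intro a b
      simp only [Equiv.coe_fn_mk, SimpleGraph.boxProd_adj, SimpleGraph.comap_adj,
        Function.Embedding.subtype_apply, Subtype.ext_iff]
      exact (hadj a b).symm

end Product

/-! ### What a leaf at `S` forces on moves and squares. -/

section Leaf

variable {V : Type u} {T : SimpleGraph V} {S L N : Finset V} {u v x y : V}

/-- After the move only `y` can dominate `e`, and an edge `ye` would close a triangle with `x`. -/
theorem slide_target_eq (hT : T.IsTree) {e : V} (hN : IsDominating T N)
    (hSN : Slide T x y S N) (hex : e ≠ x) (he : ∀ s ∈ S, Dominates T s e → s = x)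
    (hxe : Dominates T x e) : e = y := by
  obtain ⟨d, hd, hde⟩ := isDominating_iff.1 hN e
  rcases (hSN.mem_iff d).1 hd with rfl | ⟨hdS, hdx⟩
  · rcases hde with h | h
    · exact h
    · exact (no_triangle hT hSN.2.2.2.2.1 h (hxe.resolve_left hex)).elim
  · exact absurd (he d hdS hde) hdx

variable [DecidableEq V]

theorem isDominating_insert_erase {D : Finset V} {a b : V} (hD : IsDominating T D)
    (h : ∀ t, Dominates T a t → (∀ d ∈ D, Dominates T d t → d = a) → Dominates T b t) :
    IsDominating T (insert b (D.erase a)) := by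
  rw [isDominating_iff] at hD ⊢
  intro t
  by_cases hd : ∃ d ∈ D, d ≠ a ∧ Dominates T d t
  · obtain ⟨d, hd, hda, hdt⟩ := hd
    exact ⟨d, by simp [hd, hda], hdt⟩
  · push Not at hd
    obtain ⟨d, hdD, hdt⟩ := hD t
    have hda : d = a := by
      by_contra hne
      exact hd d hdD hne hdt
    subst hda
    refine ⟨b, by simp, h t hdt fun e he het => ?_⟩
    by_contra hne
    exact hd e he hne het

/-- `S` is the only neighbour of `L` in the `γ`-graph. -/
def OnlyNbr (T : SimpleGraph V) (L S : Finset V) : Prop :=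
  ∀ a b F, IsGammaSet T F → Slide T a b L F → F = S

/-- If `L` is a leaf reached from `S` by moving `u`, and `x` can be moved in `S`, then moving
`x` is prevented in `L` by a common neighbour of `u` and `x`. -/
theorem exists_blocking_nbr (hL : IsGammaSet T L) (hN : IsGammaSet T N)
    (hSL : Slide T u v S L) (hleaf : OnlyNbr T L S) (hSN : Slide T x y S N) (hxu : x ≠ u) :
    ∃ w, T.Adj u w ∧ T.Adj x w ∧ (∀ s ∈ S, Dominates T s w → s = u ∨ s = x) ∧
      ¬ Dominates T v w ∧ ¬ Dominates T y w := by
  obtain ⟨hu, hv, huL, hvL, huv, hoL⟩ := hSL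
  obtain ⟨hx, hy, hxN, hyN, hxy, hoN⟩ := hSN
  have hxv : x ≠ v := fun h => hv (h ▸ hx)
  have hxL : x ∈ L := (hoL x hxu hxv).1 hx
  -- Moving `x` in `L` would give a neighbour of `L` without `x`, hence different from `S`.
  have hnd : ¬ IsDominating T (insert y (L.erase x)) := by
    intro hd
    have h := hleaf x y _ (isGammaSet_insert_erase hL hxL hd) (slide_insert_erase hL hxL hxy hd)
    have : x ∈ insert y (L.erase x) := h ▸ hx
    have := hxy.ne
    grind
  rw [isDominating_iff] at hnd
  push Not at hnd
  obtain ⟨w, hw⟩ := hnd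
  have hyw : ¬ Dominates T y w := hw y (by simp)
  have hvw : ¬ Dominates T v w := hw v (by simp [hvL, hxv.symm])
  have hsw : ∀ s ∈ S, Dominates T s w → s = u ∨ s = x := by
    intro s hs hsw
    by_contra hne
    push Not at hne
    have hsv : s ≠ v := fun h => hv (h ▸ hs)
    exact hw s (by simp [hne.2, (hoL s hne.1 hsv).1 hs]) hsw
  have huw : Dominates T u w := by
    obtain ⟨d, hd, hdw⟩ := isDominating_iff.1 hN.1 w
    by_cases hdy : d = y
    · exact absurd (hdy ▸ hdw) hyw
    · have hdx : d ≠ x := fun h => hxN (h ▸ hd)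
      rcases hsw d ((hoN d hdx hdy).2 hd) hdw with rfl | h
      · exact hdw
      · exact absurd h hdx
  have hxw : Dominates T x w := by
    obtain ⟨d, hd, hdw⟩ := isDominating_iff.1 hL.1 w
    by_cases hdv : d = v
    · exact absurd (hdv ▸ hdw) hvw
    · have hdu : d ≠ u := fun h => huL (h ▸ hd)
      rcases hsw d ((hoL d hdu hdv).2 hd) hdw with h | rfl
      · exact absurd h hdu
      · exact hdw
  refine ⟨w, huw.resolve_left ?_, hxw.resolve_left ?_, hsw, hvw, hyw⟩
  · rintro rfl
    exact hvw (Or.inr huv.symm)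
  · rintro rfl
    exact hyw (Or.inr hxy.symm)

theorem slide_target_unique (hT : T.IsTree) {e y' : V} {N' : Finset V} (hN : IsDominating T N)
    (hSN : Slide T x y S N) (hN' : IsDominating T N') (hSN' : Slide T x y' S N') (hex : e ≠ x)
    (he : ∀ s ∈ S, Dominates T s e → s = x) (hxe : Dominates T x e) : N = N' := by
  obtain rfl := (slide_target_eq hT hN hSN hex he hxe).symm.trans
    (slide_target_eq hT hN' hSN' hex he hxe)
  exact hSN.eq.trans hSN'.eq.symm

/-- No element other than `u` lacks an external private neighbour when moving `u` gives a
leaf. -/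
theorem eq_of_no_external (hT : T.IsTree) (hL : IsGammaSet T L)
    (hSL : Slide T u v S L)
    (hleaf : OnlyNbr T L S) {z : V} (hz : z ∈ S)
    (hne : ∀ y, Dominates T z y → (∀ s ∈ S, Dominates T s y → s = z) → y = z) : z = u := by
  by_contra hzu
  obtain ⟨hu, hv, huL, hvL, huv, hoL⟩ := hSL
  have hzv : z ≠ v := fun h => hv (h ▸ hz)
  have hzL : z ∈ L := (hoL z hzu hzv).1 hz
  obtain ⟨n, hzn⟩ : ∃ n, T.Adj z n := by
    have : Nontrivial V := ⟨z, u, hzu⟩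
    exact hT.connected.preconnected.exists_adj_of_nontrivial z
  have hnd : ∀ b, T.Adj z b → ¬ IsDominating T (insert b (L.erase z)) := by
    intro b hzb hd
    have h := hleaf z b _ (isGammaSet_insert_erase hL hzL hd) (slide_insert_erase hL hzL hzb hd)
    have : z ∈ insert b (L.erase z) := h ▸ hz
    have := hzb.ne
    grind
  -- Such a `t` is not private to `z` in `S`, so it became private by the departure of `u`. At most
  -- one vertex is adjacent to both `z` and `u`, so `z` could move there, or anywhere if there is no
  -- such `t`.
  have common : ∀ t, t ≠ z → Dominates T z t → (∀ d ∈ L, Dominates T d t → d = z) →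
      T.Adj z t ∧ T.Adj u t := by
    intro t htz hzt hall
    have hzt' := hzt.resolve_left htz
    refine ⟨hzt', ?_⟩
    by_contra hut
    have htu : t ≠ u := by
      rintro rfl
      exact hzv (hall v hvL (Or.inr huv.symm)).symm
    apply htz
    apply hne t hzt
    intro s hs hst
    by_cases hsu : s = u
    · subst hsu
      rcases hst with h | h
      · exact absurd h htu
      · exact absurd h hut
    · exact hall s ((hoL s hsu (fun h => hv (h ▸ hs))).1 hs) hst
  by_cases hw : ∃ w, w ≠ z ∧ Dominates T z w ∧ ∀ d ∈ L, Dominates T d w → d = z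
  · obtain ⟨w, hwz, hzw, hall⟩ := hw
    obtain ⟨h1, h2⟩ := common w hwz hzw hall
    refine hnd w h1 (isDominating_insert_erase hL.1 fun t hzt hallt => ?_)
    by_cases htz : t = z
    · exact Or.inr (htz ▸ h1.symm)
    · obtain ⟨h3, h4⟩ := common t htz hzt hallt
      exact Or.inl (eq_of_common_nbr hT hzu h3 h4 h1 h2)
  · push Not at hw
    refine hnd n hzn (isDominating_insert_erase hL.1 fun t hzt hallt => ?_)
    by_cases htz : t = z
    · exact Or.inr (htz ▸ hzn.symm)
    · obtain ⟨d, hd, hdt, hdz⟩ := hw t htz hzt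
      exact absurd (hallt d hd hdt) hdz

/-- Two different moves of the same vertex do not lie in a common square. -/
theorem eq_of_common_slide_same (hT : T.IsTree) {p q a b a' b' : V} {P Q F : Finset V}
    (hP : Slide T u p S P) (hQ : Slide T u q S Q) (hpq : p ≠ q) (hPF : Slide T a b P F)
    (hQF : Slide T a' b' Q F) : F = S := by
  have t1 := @no_triangle V T hT
  have t2 := @eq_of_common_nbr V T hT
  by_contra hFS
  have hoP := hP.mem_iff
  have hoQ := hQ.mem_iff
  have hoF := hPF.mem_iff
  have hoF' := hQF.mem_iff
  obtain ⟨hu, hp, huP, hpP, hup, -⟩ := hP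
  obtain ⟨-, hq, huQ, hqQ, huq, -⟩ := hQ
  obtain ⟨haP, hbP, haF, hbF, hab, -⟩ := hPF
  obtain ⟨haQ, hbQ, haF', hbF', hab', -⟩ := hQF
  -- Unless `F = S`, the vertices `p` and `q` acquire a common neighbour besides `u`: the common
  -- target of both slides if `a = p`, their common origin otherwise.
  by_cases hap : a = p
  · subst hap
    by_cases hbu : b = u
    · subst hbu
      apply hFS
      ext t
      grind
    · have hbq : b ≠ q := by
        rintro rfl
        exact t1 hup hab huq
      have haq : a' = q := by grind
      subst haq
      have hbb : b' = b := by grind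
      subst hbb
      exact hpq (t2 (fun h => hbu h.symm) hup hab.symm huq hab'.symm)
  · have hpF : p ∈ F := by grind [T.irrefl]
    have hbp : p = b' := by grind
    subst hbp
    have haq : a' ≠ q := by
      rintro rfl
      exact t1 huq hab' hup
    have hbq : q = b := by grind
    subst hbq
    have haa : a = a' := by grind [T.irrefl]
    subst haa
    have hau : a ≠ u := by grind
    exact hpq (t2 hau hab' hup hab huq)

/-- A move of `x` and a move of `u` to `p` lie in a common square only if `p` is the common
neighbour of `u` and `x`. -/
theorem eq_of_common_slide (hT : T.IsTree) {w p a b a' b' : V} {P F : Finset V}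
    (hxu : x ≠ u) (huw : T.Adj u w) (hxw : T.Adj x w)
    (hw : ∀ s ∈ S, Dominates T s w → s = u ∨ s = x) (hyw : ¬ Dominates T y w)
    (hN : Slide T x y S N) (hP : Slide T u p S P) (hNF : Slide T a b N F)
    (hPF : Slide T a' b' P F) (hF : IsDominating T F) (hFS : F ≠ S) : p = w := by
  have t1 := @no_triangle V T hT
  have hoN := hN.mem_iff
  have hoP := hP.mem_iff
  have hoF := hNF.mem_iff
  have hoF' := hPF.mem_iff
  obtain ⟨hx, hy, hxN, hyN, hxy, -⟩ := hN
  obtain ⟨hu, hp, huP, hpP, hup, -⟩ := hP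
  obtain ⟨haN, hbN, haF, hbF, hab, -⟩ := hNF
  obtain ⟨haP, hbP, haF', hbF', hab', -⟩ := hPF
  have hux : ¬ T.Adj u x := fun h => t1 h hxw huw
  by_cases hyp : y = p
  · subst hyp
    by_contra hne
    exact hne (eq_of_common_nbr hT hxu hxy hup hxw huw)
  by_cases hbx : b = x
  · subst hbx
    by_cases hay : a = y
    · subst hay
      exact absurd (by ext t; grind) hFS
    · have hyb : y = b' := by grind [T.irrefl]
      have hpa : a' = p := by grind
      have hau : a = u := by grind
      exact absurd (hau ▸ hab) hux
  · have hxa : a' = x := by grind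
    by_cases hbu : b' = u
    · exact absurd (hxa ▸ hbu ▸ hab').symm hux
    · have hau : a = u := by grind
      have hyb : y = b' := by grind
      have hpb : p = b := by grind
      -- Here `F` carries out both moves, so `p` is its only element that can dominate `w`.
      obtain ⟨d, hd, hdw⟩ := isDominating_iff.1 hF w
      have hdp : d = p := by
        by_contra hdp
        have hdy : d ≠ y := fun h => hyw (h ▸ hdw)
        have hdS : d ∈ S := by grind
        have := hw d hdS hdw
        grind
      subst hdp
      rcases hdw with h | h
      · exact h.symm
      · exact (t1 hup h huw).elim

end Leaf

/-! ### A product forces external private neighbours. -/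

section Forward

variable {V : Type u} [DecidableEq V] {T : SimpleGraph V}

theorem isExternalPrivateNbr_iff {D : Finset V} {x y : V} :
    IsExternalPrivateNbr T D x y ↔
      y ≠ x ∧ Dominates T x y ∧ ∀ s ∈ D, Dominates T s y → s = x := by
  simp only [IsExternalPrivateNbr, privateNbrs, closedNbhdSet, closedNbhd, Set.mem_sdiff,
    Set.mem_ofPred_eq, Finset.mem_erase, not_exists, not_and, Dominates]
  grind

theorem onlyNbr_of_mem_leavesAt {L S : {D : Finset V // IsGammaSet T D}}
    (h : L ∈ leavesAt (gammaGraph T) S) : OnlyNbr T L.1 S.1 := fun a b F hF hLF =>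
  congrArg Subtype.val (eq_of_adj_isLeaf h (t := ⟨F, hF⟩) (gammaGraph_adj_iff.2 ⟨a, b, hLF⟩))

theorem exists_three_of_le_ncard {W : Type u} [Finite W] {G : SimpleGraph W} {s : W}
    (h : 3 ≤ ((deleteLeavesAt G s).neighborSet ⟨s, self_mem_compl_leavesAt G s⟩).ncard) :
    ∃ n₁ n₂ n₃, n₁ ≠ n₂ ∧ n₁ ≠ n₃ ∧ n₂ ≠ n₃ ∧ (G.Adj s n₁ ∧ n₁ ∉ leavesAt G s) ∧
      (G.Adj s n₂ ∧ n₂ ∉ leavesAt G s) ∧ (G.Adj s n₃ ∧ n₃ ∉ leavesAt G s) := by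
  obtain ⟨a, b, c, ha, hb, hc, hab, hac, hbc⟩ := (Set.two_lt_ncard_iff).1 h
  exact ⟨a, b, c, fun h => hab (Subtype.ext h), fun h => hac (Subtype.ext h),
    fun h => hbc (Subtype.ext h), ⟨ha, a.2⟩, ⟨hb, b.2⟩, ⟨hc, c.2⟩⟩

/-- If `x` can move and `u` is its own only private neighbour, then moving `u` to the common
neighbour of `u` and `x` gives a neighbour of `S` which is not a leaf. -/
theorem exists_nonleaf_slide (hT : T.IsTree) {S L N : {D : Finset V // IsGammaSet T D}}
    {u v x y : V} (hL : L ∈ leavesAt (gammaGraph T) S) (hSL : Slide T u v S.1 L.1)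
    (hu : ∀ y, Dominates T u y → (∀ s ∈ S.1, Dominates T s y → s = u) → y = u)
    (hSN : Slide T x y S.1 N.1) (hxu : x ≠ u) :
    ∃ w, T.Adj u w ∧ T.Adj x w ∧ (∀ s ∈ S.1, Dominates T s w → s = u ∨ s = x) ∧
      ¬ Dominates T y w ∧ ∃ P : {D : Finset V // IsGammaSet T D},
        Slide T u w S.1 P.1 ∧ P ∉ leavesAt (gammaGraph T) S := by
  obtain ⟨w, huw, hxw, hw, hvw, hyw⟩ :=
    exists_blocking_nbr L.2 N.2 hSL (onlyNbr_of_mem_leavesAt hL) hSN hxu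
  have hdom : IsDominating T (insert w (S.1.erase u)) :=
    isDominating_insert_erase S.2.1 fun t hut hall => hu t hut hall ▸ Or.inr huw.symm
  have hsl := slide_insert_erase S.2 hSL.1 huw hdom
  have hP := isGammaSet_insert_erase S.2 hSL.1 hdom
  refine ⟨w, huw, hxw, hw, hyw, ⟨_, hP⟩, hsl, fun hleaf => ?_⟩
  have hmem := hsl.mem_iff
  set P := insert w (S.1.erase u)
  have hxw' : x ≠ w := hxw.ne
  have hxP : x ∈ P := (hmem x).2 (Or.inr ⟨hSN.1, hxu⟩)
  have hxy : T.Adj x y := hSN.2.2.2.2.1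
  -- The move of `x` to `y` remains possible in `P`, because `w` dominates what `x` and `u` shared;
  -- so `P` has a neighbour other than `S`.
  have hd : IsDominating T (insert y (P.erase x)) := by
    refine isDominating_insert_erase hP.1 fun t hxt hall => ?_
    have h1 : ¬ Dominates T w t := fun h => hxw' (hall w hsl.2.2.2.1 h).symm
    obtain ⟨d, hd, hdt⟩ := isDominating_iff.1 N.2.1 t
    rcases (hSN.mem_iff d).1 hd with rfl | ⟨hdS, hdx⟩
    · exact hdt
    · have hdu : d = u := by
        by_contra hdu
        exact hdx (hall d ((hmem d).2 (Or.inr ⟨hdS, hdu⟩)) hdt)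
      subst hdu
      rcases hdt with rfl | hdt
      · exact absurd (Or.inr huw.symm) h1
      · rcases hxt with rfl | hxt
        · exact Or.inr hxy.symm
        · exact absurd (Or.inl (eq_of_common_nbr hT hxu hxt hdt hxw huw)) h1
  have h := onlyNbr_of_mem_leavesAt hleaf x y _ (isGammaSet_insert_erase hP hxP hd)
    (slide_insert_erase hP hxP hxy hd)
  exact (slide_insert_erase hP hxP hxy hd).2.2.1 (h ▸ hSN.1)

theorem exists_external_of_isCartesianProductGraph [Finite V] (hT : T.IsTree)
    (S : {D : Finset V // IsGammaSet T D}) (hS : IsStem (gammaGraph T) S)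
    (hdeg : 3 ≤ ((deleteLeavesAt (gammaGraph T) S).neighborSet
      ⟨S, self_mem_compl_leavesAt (gammaGraph T) S⟩).ncard)
    (hprod : IsCartesianProductGraph (deleteLeavesAt (gammaGraph T) S)) :
    ∀ x ∈ S.1, ∃ y, IsExternalPrivateNbr T S.1 x y := by
  by_contra hcon
  push Not at hcon
  obtain ⟨z, hz, hzy⟩ := hcon
  simp only [isExternalPrivateNbr_iff] at hzy
  have hzy' : ∀ y, Dominates T z y → (∀ s ∈ S.1, Dominates T s y → s = z) → y = z := by
    intro y h1 h2
    by_contra hne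
    exact hzy y ⟨hne, h1, h2⟩
  obtain ⟨L, hL⟩ := hS
  have hleaf := onlyNbr_of_mem_leavesAt hL
  obtain ⟨u, v, hSL⟩ := gammaGraph_adj_iff.1 hL.1
  obtain rfl := eq_of_no_external hT L.2 hSL hleaf hz hzy'
  have hext : ∀ x ∈ S.1, x ≠ z →
      ∃ e, e ≠ x ∧ Dominates T x e ∧ ∀ s ∈ S.1, Dominates T s e → s = x := by
    intro x hx hxz
    by_contra hcon
    push Not at hcon
    refine hxz (eq_of_no_external hT L.2 hSL hleaf hx fun y h1 h2 => ?_)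
    by_contra hne
    obtain ⟨s, hs, hsy, hsx⟩ := hcon y hne h1
    exact hsx (h2 s hs hsy)
  obtain ⟨P, Q, p, q, hpq, hP, hQ, hPl, hQl⟩ : ∃ P Q : {D : Finset V // IsGammaSet T D}, ∃ p q,
      p ≠ q ∧ Slide T z p S.1 P.1 ∧ Slide T z q S.1 Q.1 ∧ P ∉ leavesAt (gammaGraph T) S ∧
        Q ∉ leavesAt (gammaGraph T) S := by
    obtain ⟨N₁, N₂, N₃, h12, h13, h23, ⟨ha₁, hl₁⟩, ⟨ha₂, hl₂⟩, ⟨ha₃, hl₃⟩⟩ :=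
      exists_three_of_le_ncard hdeg
    obtain ⟨a₁, b₁, hs₁⟩ := gammaGraph_adj_iff.1 ha₁
    obtain ⟨a₂, b₂, hs₂⟩ := gammaGraph_adj_iff.1 ha₂
    obtain ⟨a₃, b₃, hs₃⟩ := gammaGraph_adj_iff.1 ha₃
    by_contra hno
    -- Pigeonhole on whether `z` is moved: two neighbours moving `z` serve directly, and two moving
    -- other elements give moves of `z` to distinct blocking neighbours `w` and `w'`.
    have same : ∀ (N N' : {D : Finset V // IsGammaSet T D}) (a b a' b' : V), N ≠ N' →
        N ∉ leavesAt (gammaGraph T) S → N' ∉ leavesAt (gammaGraph T) S →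
        Slide T a b S.1 N.1 → Slide T a' b' S.1 N'.1 → ¬ (a = z ↔ a' = z) := by
      intro N N' a b a' b' hNN hl hl' hs hs' hiff
      by_cases haz : a = z
      · have haz' := hiff.1 haz
        subst haz'
        subst haz
        refine hno ⟨N, N', b, b', ?_, hs, hs', hl, hl'⟩
        rintro rfl
        exact hNN (Subtype.ext (hs.eq.trans hs'.eq.symm))
      · have haz' : a' ≠ z := fun h => haz (hiff.2 h)
        obtain ⟨w, -, hxw, hw, -, P, hP, hPl⟩ := exists_nonleaf_slide hT hL hSL hzy' hs haz
        obtain ⟨w', -, hxw', hw', -, Q, hQ, hQl⟩ := exists_nonleaf_slide hT hL hSL hzy' hs' haz'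
        refine hno ⟨P, Q, w, w', ?_, hP, hQ, hPl, hQl⟩
        rintro rfl
        have haa : a' = a := (hw a' hs'.1 (Or.inr hxw')).resolve_left haz'
        subst haa
        obtain ⟨e, he, hae, hall⟩ := hext a' hs.1 haz
        exact hNN (Subtype.ext (slide_target_unique hT N.2.1 hs N'.2.1 hs' he hall hae))
    have e1 := same _ _ _ _ _ _ h12 hl₁ hl₂ hs₁ hs₂
    have e2 := same _ _ _ _ _ _ h13 hl₁ hl₃ hs₁ hs₃
    have e3 := same _ _ _ _ _ _ h23 hl₂ hl₃ hs₂ hs₃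
    tauto
  have hconn := deleteLeavesAt_connected (gammaGraph_preconnected hT) S
  have hGF : ∀ {X F : ((leavesAt (gammaGraph T) S)ᶜ : Set _)},
      (deleteLeavesAt (gammaGraph T) S).Adj X F → ∃ a b, Slide T a b X.1.1 F.1.1 :=
    fun h => gammaGraph_adj_iff.1 h
  rcases exists_common_nbr_of_isCartesianProductGraph hconn hprod
    (s := ⟨S, self_mem_compl_leavesAt (gammaGraph T) S⟩) (p := ⟨P, hPl⟩) (q := ⟨Q, hQl⟩)
    (gammaGraph_adj_iff.2 ⟨z, p, hP⟩) (gammaGraph_adj_iff.2 ⟨z, q, hQ⟩) with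
    ⟨F, hF, h1, h2⟩ | ⟨X, hXP, hXQ, hSX, ⟨F, hF, h1, h2⟩, F', hF', h3, h4⟩
  · obtain ⟨a, b, h1⟩ := hGF h1
    obtain ⟨a', b', h2⟩ := hGF h2
    exact hF (Subtype.ext (Subtype.ext (eq_of_common_slide_same hT hP hQ hpq h1 h2)))
  · obtain ⟨c, d, hSX⟩ := hGF hSX
    obtain ⟨a, b, h1⟩ := hGF h1
    obtain ⟨a', b', h2⟩ := hGF h2
    obtain ⟨a₃, b₃, h3⟩ := hGF h3
    obtain ⟨a₄, b₄, h4⟩ := hGF h4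
    by_cases hcz : c = z
    · subst hcz
      have hdp : d ≠ p := by
        rintro rfl
        exact hXP (Subtype.ext (Subtype.ext (hSX.eq.trans hP.eq.symm)))
      exact hF (Subtype.ext (Subtype.ext (eq_of_common_slide_same hT hSX hP hdp h1 h2)))
    · obtain ⟨w, huw, hxw, hw, hyw, -⟩ := exists_nonleaf_slide hT hL hSL hzy' hSX hcz
      have e1 := eq_of_common_slide hT hcz huw hxw hw hyw hSX hP h1 h2 F.1.2.1
        (fun h => hF (Subtype.ext (Subtype.ext h)))
      have e2 := eq_of_common_slide hT hcz huw hxw hw hyw hSX hQ h3 h4 F'.1.2.1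
        (fun h => hF' (Subtype.ext (Subtype.ext h)))
      exact hpq (e1.trans e2.symm)

end Forward

/-! ### Mixing two `γ`-sets along a union of branches. -/

section Mix

variable {V : Type u} [DecidableEq V] {T : SimpleGraph V}

open Classical in
/-- The set that agrees with `D` on `P` and with `E` off `P`. -/
noncomputable def mix (P : Set V) (D E : Finset V) : Finset V :=
  {t ∈ D | t ∈ P} ∪ {t ∈ E | t ∉ P}

theorem mem_mix {P : Set V} {D E : Finset V} {t : V} :
    t ∈ mix P D E ↔ t ∈ D ∧ t ∈ P ∨ t ∈ E ∧ t ∉ P := by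
  simp [mix]

theorem card_mix_add_card_mix (P : Set V) (D E : Finset V) :
    (mix P D E).card + (mix P E D).card = D.card + E.card := by
  classical
  have h : ∀ D E : Finset V, (mix P D E).card =
      (D.filter (· ∈ P)).card + (E.filter (· ∉ P)).card := by
    intro D E
    rw [← Finset.card_union_of_disjoint]
    · congr 1
    · rw [Finset.disjoint_left]
      intro t
      simp +contextual
  rw [h D E, h E D, ← Finset.card_filter_add_card_filter_not (s := D) (· ∈ P),
    ← Finset.card_filter_add_card_filter_not (s := E) (· ∈ P)]
  ring

/-- Every edge leaving `P` ends in `z`, and `z` belongs to the mix because it lies in `E` and off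
`P`. -/
theorem isDominating_mix {P : Set V} {z : V} (hP : IsBranchUnion T z P) {D E : Finset V}
    (hD : IsDominating T D) (hE : IsDominating T E) (hz : z ∈ E) :
    IsDominating T (mix P D E) := by
  rw [isDominating_iff] at hD hE ⊢
  have hzm : z ∈ mix P D E := mem_mix.2 (Or.inr ⟨hz, hP.1⟩)
  intro t
  by_cases htP : t ∈ P
  · obtain ⟨d, hd, hdt⟩ := hD t
    by_cases hdP : d ∈ P
    · exact ⟨d, mem_mix.2 (Or.inl ⟨hd, hdP⟩), hdt⟩
    · have hadj : T.Adj d t := hdt.resolve_left fun h => hdP (h ▸ htP)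
      exact ⟨z, hzm, hP.2 t htP d hdP hadj.symm ▸ hdt⟩
  · obtain ⟨d, hd, hdt⟩ := hE t
    by_cases hdP : d ∈ P
    · have hadj : T.Adj d t := hdt.resolve_left fun h => htP (h ▸ hdP)
      exact ⟨z, hzm, Or.inl (hP.2 d hdP t htP hadj)⟩
    · exact ⟨d, mem_mix.2 (Or.inr ⟨hd, hdP⟩), hdt⟩

/-- Both mixes dominate and their sizes add up to those of `D` and `E`, so neither can be larger
than minimum. -/
theorem isGammaSet_mix {P : Set V} {z : V} (hP : IsBranchUnion T z P) {D E : Finset V}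
    (hD : IsGammaSet T D) (hE : IsGammaSet T E) (hzD : z ∈ D) (hzE : z ∈ E) :
    IsGammaSet T (mix P D E) := by
  refine isGammaSet_of_card_le hD (isDominating_mix hP hD.1 hE.1 hzE) ?_
  have h1 := hE.2 _ (isDominating_mix hP hE.1 hD.1 hzD)
  have h2 := card_mix_add_card_mix P D E
  omega

/-- While `z` stays in place, no slide can cross between `P` and the rest. -/
theorem slide_mix_iff {P : Set V} {z : V} (hP : IsBranchUnion T z P) {D E S : Finset V}
    (hzD : z ∈ D) (hzE : z ∈ E) :
    (∃ a b, Slide T a b D E) ↔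
      ((∃ a b, Slide T a b (mix P D S) (mix P E S)) ∧ mix P S D = mix P S E) ∨
      ((∃ a b, Slide T a b (mix P S D) (mix P S E)) ∧ mix P D S = mix P E S) := by
  constructor
  · rintro ⟨a, b, ha, hb, haE, hbE, hab, ho⟩
    have haz : a ≠ z := fun h => haE (h ▸ hzE)
    have hbz : b ≠ z := fun h => hb (h ▸ hzD)
    have hiff := hP.mem_iff_of_adj hab haz hbz
    by_cases haP : a ∈ P
    · refine Or.inl ⟨⟨a, b, ?_, ?_, ?_, ?_, hab, fun t h1 h2 => ?_⟩, Finset.ext fun t => ?_⟩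
      all_goals simp only [mem_mix]
      -- Goal 6 is the equality of the other two mixes; `ho` says nothing about `t = a` and `t = b`,
      -- so these are split off.
      on_goal 6 => rcases eq_or_ne t a with rfl | h1
      on_goal 7 => rcases eq_or_ne t b with rfl | h2
      all_goals grind
    · refine Or.inr ⟨⟨a, b, ?_, ?_, ?_, ?_, hab, fun t h1 h2 => ?_⟩, Finset.ext fun t => ?_⟩
      all_goals simp only [mem_mix]
      on_goal 6 => rcases eq_or_ne t a with rfl | h1
      on_goal 7 => rcases eq_or_ne t b with rfl | h2
      all_goals grind
  · rintro (⟨⟨a, b, ha, hb, haE, hbE, hab, ho⟩, he⟩ | ⟨⟨a, b, ha, hb, haE, hbE, hab, ho⟩, he⟩)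
    all_goals
      rw [Finset.ext_iff] at he
      simp only [mem_mix] at ha hb haE hbE ho he
      refine ⟨a, b, ?_, ?_, ?_, ?_, hab, fun t h1 h2 => ?_⟩
    · grind
    · grind
    · grind
    · grind
    · have := ho t h1 h2
      have := he t
      grind
    · grind
    · grind
    · grind
    · grind
    · have := ho t h1 h2
      have := he t
      grind

end Mix

/-! ### External private neighbours force a product. -/

section Backward

variable {V : Type u} {T : SimpleGraph V}
  {S L : {D : Finset V // IsGammaSet T D}} {u v : V}

/-- The neighbours of `u` that prevent some other element of `S` from moving once `u` has moved
to `v`. -/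
def blockers (T : SimpleGraph V) (S : Finset V) (u v : V) : Set V :=
  {w | T.Adj u w ∧ w ≠ v ∧ ∃ x, x ≠ u ∧ T.Adj x w ∧ ∀ s ∈ S, Dominates T s w → s = u ∨ s = x}

/-- The union of the branches at `u` that start with a blocking neighbour. -/
def blockedPart (T : SimpleGraph V) (S : Finset V) (u v : V) : Set V :=
  {t | ∃ w ∈ blockers T S u v, t ∈ branch T u w}

theorem isBranchUnion_blockedPart (S : Finset V) : IsBranchUnion T u (blockedPart T S u v) := by
  constructor
  · rintro ⟨w, hw, h⟩
    exact (isBranchUnion_branch hw.1.ne').1 h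
  · rintro a ⟨w, hw, h⟩ b hb hab
    exact (isBranchUnion_branch hw.1.ne').2 a h b (fun hb' => hb ⟨w, hw, hb'⟩) hab

theorem notMem_blockedPart (hT : T.IsTree) (S : Finset V) (huv : T.Adj u v) :
    v ∉ blockedPart T S u v := by
  rintro ⟨w, hw, h⟩
  exact notMem_branch hT hw.1 huv hw.2.1 h

/-- Supplies `hK` in `exists_slideIn`: outside `P` only `z` can be dominated from within, and `v`
takes care of `z`. -/
theorem exists_dominates_notMem {P : Set V} {z v : V} (hP : IsBranchUnion T z P) {D : Finset V}
    (hD : IsDominating T D) (hv : v ∈ D) (hvP : v ∉ P) (hvz : Dominates T v z) :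
    ∀ t ∉ P, ∃ k ∈ D, k ∉ P ∧ Dominates T k t := by
  intro t ht
  obtain ⟨d, hd, hdt⟩ := isDominating_iff.1 hD t
  by_cases hdP : d ∈ P
  · have hadj : T.Adj d t := hdt.resolve_left fun h => ht (h ▸ hdP)
    exact ⟨v, hv, hvP, hP.2 d hdP t ht hadj ▸ hvz⟩
  · exact ⟨d, hd, hdP, hdt⟩

/-- Within `S` only `u` and `x` may dominate `w`, so `x'` witnesses `w ≠ w'`, and different
neighbours of `u` start different branches. -/
theorem branch_ne (hT : T.IsTree) (S : Finset V) {w w' x x' : V} (hw : w ∈ blockers T S u v)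
    (hw' : w' ∈ blockers T S u v) (hS : ∀ s ∈ S, Dominates T s w → s = u ∨ s = x)
    (hxw' : T.Adj x' w') (hx' : x' ∈ S) (hxu : x' ≠ u) (hxx : x ≠ x') {t : V}
    (ht : t ∈ branch T u w') (hxt : x' = t ∨ T.Adj x' t) (htu : t ≠ u) : t ∉ branch T u w := by
  have hne : w ≠ w' := by
    rintro rfl
    exact hxx ((hS x' hx' (Or.inr hxw')).resolve_left hxu).symm
  have hB := isBranchUnion_branch (T := T) hw.1.ne'
  have h1 := notMem_branch hT hw.1 hw'.1 hne
  have h2 : x' ∉ branch T u w := fun h => h1 ((hB.mem_iff_of_adj hxw' hxu hw'.1.ne').1 h)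
  rcases hxt with rfl | hxt
  · exact h2
  · exact fun h => h2 ((hB.mem_iff_of_adj hxt hxu htu).2 h)

variable [DecidableEq V]

theorem exists_blocker (hL : L ∈ leavesAt (gammaGraph T) S) (hSL : Slide T u v S.1 L.1)
    {N : {D : Finset V // IsGammaSet T D}} {x y : V} (hSN : Slide T x y S.1 N.1) (hxu : x ≠ u) :
    ∃ w ∈ blockers T S.1 u v, x ∈ branch T u w ∧ y ∈ branch T u w ∧ T.Adj x w ∧
      ∀ s ∈ S.1, Dominates T s w → s = u ∨ s = x := by
  obtain ⟨w, huw, hxw, hw, hvw, -⟩ :=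
    exists_blocking_nbr L.2 N.2 hSL (onlyNbr_of_mem_leavesAt hL) hSN hxu
  have hx : x ∈ branch T u w := Relation.ReflTransGen.single ⟨hxw.symm, hxu⟩
  have hyu : y ≠ u := fun h => hSN.2.1 (h ▸ hSL.1)
  exact ⟨w, ⟨huw, fun h => hvw (Or.inl h), x, hxu, hxw, hw⟩, hx,
    Relation.ReflTransGen.tail hx ⟨hSN.2.2.2.2.1, hyu⟩, hxw, hw⟩

/-- If `D` differed from `S` there, mixing would give another `γ`-set differing from `S` only in
`B`, hence a slide of `S` inside `B`; but elements of `S` other than `u` move only inside the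
blocked part. -/
theorem agree_off_blockedPart (hT : T.IsTree) (hL : L ∈ leavesAt (gammaGraph T) S)
    (hSL : Slide T u v S.1 L.1) {D : Finset V} (hD : IsGammaSet T D) (huD : u ∈ D) :
    ∀ t ∉ blockedPart T S.1 u v, (t ∈ D ↔ t ∈ S.1) := by
  have hB := (isBranchUnion_blockedPart (T := T) (u := u) (v := v) S.1).compl
  set B := {t | t ∉ blockedPart T S.1 u v ∧ t ≠ u}
  have hF := isGammaSet_mix hB hD S.2 huD hSL.1
  have hEq : S = ⟨mix B D S.1, hF⟩ := by
    by_contra hne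
    obtain ⟨N, hN, hag⟩ := exists_slideIn hT (B := B) hne
      (by intro t ht; simp [mem_mix, ht])
      (exists_dominates_notMem hB S.2.1 hSL.1 hB.1 (Or.inl rfl))
    obtain ⟨a, b, hab⟩ := gammaGraph_adj_iff.1 hN
    have haB : a ∈ B := by
      by_contra haB
      exact hab.2.2.1 ((hag a haB).1 hab.1)
    obtain ⟨w, hw, ha, -⟩ := exists_blocker hL hSL hab haB.2
    exact haB.1 ⟨w, hw, ha⟩
  intro t ht
  by_cases htu : t = u
  · simp [htu, huD, hSL.1]
  · have htB : t ∈ B := ⟨ht, htu⟩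
    have h : t ∈ S.1 ↔ t ∈ mix B D S.1 := Finset.ext_iff.1 (congrArg Subtype.val hEq) t
    rw [h]
    simp [mem_mix, htB]

/-- The external private neighbour of `u` is `v`, and it stays private in `D`, so `u` again moves to
`v`. Thus `D'` agrees with `L` off the blocked part; were they different, `L` could slide inside
that part, whereas its only neighbour `S` differs from it at `u`. -/
theorem eq_leaf_of_slide (hT : T.IsTree) (hL : L ∈ leavesAt (gammaGraph T) S)
    (hSL : Slide T u v S.1 L.1) (hext : ∃ y, IsExternalPrivateNbr T S.1 u y)
    {D D' : {D : Finset V // IsGammaSet T D}} {a b : V} (hDD' : Slide T a b D.1 D'.1)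
    (huD : u ∈ D.1) (huD' : u ∉ D'.1) : D' = L := by
  have hB := isBranchUnion_blockedPart (T := T) (u := u) (v := v) S.1
  have huv := hSL.2.2.2.2.1
  have hvB := notMem_blockedPart hT S.1 huv
  have hag := agree_off_blockedPart hT hL hSL D.2 huD
  have hau : a = u := by
    by_contra hau
    exact huD' ((hDD'.mem_iff u).2 (Or.inr ⟨huD, fun h => hau h.symm⟩))
  subst hau
  obtain ⟨e, he⟩ := hext
  obtain ⟨hea, hae, hall⟩ := isExternalPrivateNbr_iff.1 he
  obtain rfl := slide_target_eq hT L.2.1 hSL hea hall hae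
  have heb : e = b := by
    refine slide_target_eq hT D'.2.1 hDD' hea (fun s hs hse => ?_) hae
    by_cases hsB : s ∈ blockedPart T S.1 a e
    · exact absurd (hB.2 s hsB e hvB (hse.resolve_left fun h => hvB (h ▸ hsB))) hea
    · exact hall s ((hag s hsB).1 hs) hse
  subst heb
  by_contra hne
  obtain ⟨F, hF, hF'⟩ := exists_slideIn hT (B := blockedPart T S.1 a e) (Ne.symm hne)
    (by
      intro t ht
      rw [hSL.mem_iff, hDD'.mem_iff, hag t ht])
    (exists_dominates_notMem hB L.2.1 hSL.2.2.2.1 hvB (Or.inr huv.symm))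
  obtain rfl := eq_of_adj_isLeaf hL hF
  exact hSL.2.2.1 ((hF' a hB.1).2 hSL.1)

theorem mem_or_eq_leaf (hT : T.IsTree) (hL : L ∈ leavesAt (gammaGraph T) S)
    (hSL : Slide T u v S.1 L.1) (hext : ∃ y, IsExternalPrivateNbr T S.1 u y)
    (D : {D : Finset V // IsGammaSet T D}) : u ∈ D.1 ∨ D = L := by
  have h := (SimpleGraph.reachable_iff_reflTransGen _ _).1 (gammaGraph_preconnected hT S D)
  induction h with
  | refl => exact Or.inl hSL.1
  | @tail D D' _ hDD' ih =>
    rcases ih with ih | rfl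
    · by_cases hu : u ∈ D'.1
      · exact Or.inl hu
      · obtain ⟨a, b, hab⟩ := gammaGraph_adj_iff.1 hDD'
        exact Or.inr (eq_leaf_of_slide hT hL hSL hext hab ih hu)
    · obtain rfl := eq_of_adj_isLeaf hL hDD'
      exact Or.inl hSL.1

theorem isCartesianProductGraph_of_external [Finite V] (hT : T.IsTree)
    (hS : IsStem (gammaGraph T) S)
    (hdeg : 3 ≤ ((deleteLeavesAt (gammaGraph T) S).neighborSet
      ⟨S, self_mem_compl_leavesAt (gammaGraph T) S⟩).ncard)
    (hext : ∀ x ∈ S.1, ∃ y, IsExternalPrivateNbr T S.1 x y) :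
    IsCartesianProductGraph (deleteLeavesAt (gammaGraph T) S) := by
  obtain ⟨L, hL⟩ := hS
  obtain ⟨u, v, hSL⟩ := gammaGraph_adj_iff.1 hL.1
  have huS := hSL.1
  have hmem := mem_or_eq_leaf hT hL hSL (hext u huS)
  have hmoved : ∀ {N N' : {D : Finset V // IsGammaSet T D}} {a b b' : V},
      Slide T a b S.1 N.1 → Slide T a b' S.1 N'.1 → N = N' := by
    intro N N' a b b' h h'
    obtain ⟨e, he⟩ := hext a h.1
    obtain ⟨h1, h2, h3⟩ := isExternalPrivateNbr_iff.1 he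
    exact Subtype.ext (slide_target_unique hT N.2.1 h N'.2.1 h' h1 h3 h2)
  obtain ⟨N₁, N₂, -, h12, -, -, ⟨ha₁, hl₁⟩, ⟨ha₂, hl₂⟩, -⟩ := exists_three_of_le_ncard hdeg
  obtain ⟨a₁, b₁, hs₁⟩ := gammaGraph_adj_iff.1 ha₁
  obtain ⟨a₂, b₂, hs₂⟩ := gammaGraph_adj_iff.1 ha₂
  have haa : a₁ ≠ a₂ := by
    rintro rfl
    exact h12 (hmoved hs₁ hs₂)
  have hau₁ : a₁ ≠ u := by
    rintro rfl
    exact hl₁ (hmoved hSL hs₁ ▸ hL)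
  have hau₂ : a₂ ≠ u := by
    rintro rfl
    exact hl₂ (hmoved hSL hs₂ ▸ hL)
  have sep : ∀ {N N' : {D : Finset V // IsGammaSet T D}} {a b a' b' : V},
      Slide T a b S.1 N.1 → Slide T a' b' S.1 N'.1 → a ≠ u → a' ≠ u → a ≠ a' →
      ∃ P, IsBranchUnion T u P ∧ a ∈ P ∧ b ∈ P ∧ a' ∉ P ∧ b' ∉ P := by
    intro N N' a b a' b' h h' hau hau' hne
    obtain ⟨w, hw, ha, hb, haw, hall⟩ := exists_blocker hL hSL h hau
    obtain ⟨w', hw', ha', hb', haw', hall'⟩ := exists_blocker hL hSL h' hau'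
    exact ⟨branch T u w, isBranchUnion_branch hw.1.ne', ha, hb,
      branch_ne hT S.1 hw hw' hall haw' h'.1 hau' hne ha' (Or.inl rfl) hau',
      branch_ne hT S.1 hw hw' hall haw' h'.1 hau' hne hb' (Or.inr h'.2.2.2.2.1)
        fun hbu => h'.2.1 (hbu ▸ huS)⟩
  -- If `D` contained `u`, it would arise by moving some `x ≠ u`, and an element of another branch
  -- could still move, giving `D` a second neighbour. Hence mixing sets that contain `u` never
  -- produces a deleted leaf.
  have hleaf : ∀ D ∈ leavesAt (gammaGraph T) S, u ∉ D.1 := by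
    intro D hD huD
    obtain ⟨x, y, hx⟩ := gammaGraph_adj_iff.1 hD.1
    have hxu : x ≠ u := fun h => hx.2.2.1 (h ▸ huD)
    obtain ⟨N, a, b, hN, hau, hxa⟩ : ∃ N : {D : Finset V // IsGammaSet T D}, ∃ a b,
        Slide T a b S.1 N.1 ∧ a ≠ u ∧ x ≠ a := by
      by_cases h : x = a₁
      · exact ⟨N₂, a₂, b₂, hs₂, hau₂, h ▸ haa⟩
      · exact ⟨N₁, a₁, b₁, hs₁, hau₁, h⟩
    obtain ⟨P, hP, hxP, hyP, haP, hbP⟩ := sep hx hN hxu hau hxa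
    have huN : u ∈ N.1 := (hN.mem_iff u).2 (Or.inr ⟨huS, hau.symm⟩)
    have hsl : Slide T a b D.1 (mix P D.1 N.1) := by
      have e1 := hx.mem_iff
      have e2 := hN.mem_iff
      obtain ⟨h1, h2, h3, h4, h5, -⟩ := hx
      obtain ⟨h6, h7, h8, h9, h10, -⟩ := hN
      refine ⟨?_, ?_, ?_, ?_, h10, fun t ht ht' => ?_⟩
      · grind
      · grind
      · rw [mem_mix]; grind
      · rw [mem_mix]; grind
      · rw [mem_mix, e1, e2]; grind
    have h := onlyNbr_of_mem_leavesAt hD a b _ (isGammaSet_mix hP D.2 N.2 huD huN) hsl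
    have hxm : x ∈ mix P D.1 N.1 := h ▸ hx.1
    rcases mem_mix.1 hxm with h | h
    · exact hx.2.2.1 h.1
    · exact h.2 hxP
  obtain ⟨P, hP, haP, hbP, haP', hbP'⟩ := sep hs₁ hs₂ hau₁ hau₂ haa
  have hu : ∀ D : ((leavesAt (gammaGraph T) S)ᶜ : Set _), u ∈ D.1.1 := fun D =>
    (hmem D.1).resolve_right fun h => D.2 (h ▸ hL)
  let m : ((leavesAt (gammaGraph T) S)ᶜ : Set _) → ((leavesAt (gammaGraph T) S)ᶜ : Set _) →
      ((leavesAt (gammaGraph T) S)ᶜ : Set _) := fun D E =>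
    ⟨⟨mix P D.1.1 E.1.1, isGammaSet_mix hP D.1.2 E.1.2 (hu D) (hu E)⟩, fun h =>
      hleaf _ h (mem_mix.2 (Or.inr ⟨hu E, hP.1⟩))⟩
  have hmP : ∀ D E t, t ∈ (m D E).1.1 ↔ t ∈ D.1.1 ∧ t ∈ P ∨ t ∈ E.1.1 ∧ t ∉ P := fun D E t =>
    mem_mix
  refine isCartesianProductGraph_of_band m ⟨S, self_mem_compl_leavesAt (gammaGraph T) S⟩
    (fun a => Subtype.ext (Subtype.ext (Finset.ext fun t => ?_)))
    (fun a b c => Subtype.ext (Subtype.ext (Finset.ext fun t => ?_)))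
    (fun a b c => Subtype.ext (Subtype.ext (Finset.ext fun t => ?_)))
    (fun D E => ?_) ⟨⟨N₁, hl₁⟩, fun h => ?_⟩ ⟨⟨N₂, hl₂⟩, fun h => ?_⟩
  · rw [hmP]; tauto
  · simp only [hmP]; tauto
  · simp only [hmP]; tauto
  · have hadj : ∀ X Y : ((leavesAt (gammaGraph T) S)ᶜ : Set _),
        (deleteLeavesAt (gammaGraph T) S).Adj X Y ↔ ∃ a b, Slide T a b X.1.1 Y.1.1 :=
      fun X Y => gammaGraph_adj_iff
    simp only [hadj, Subtype.ext_iff]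
    exact slide_mix_iff hP (hu D) (hu E)
  · have h1 : a₁ ∈ (m ⟨N₁, hl₁⟩ ⟨S, self_mem_compl_leavesAt (gammaGraph T) S⟩).1.1 := by
      rw [h]
      exact hs₁.1
    rcases (hmP _ _ _).1 h1 with h | h
    · exact hs₁.2.2.1 h.1
    · exact h.2 haP
  · have h1 : a₂ ∈ (m ⟨S, self_mem_compl_leavesAt (gammaGraph T) S⟩ ⟨N₂, hl₂⟩).1.1 := by
      rw [h]
      exact hs₂.1
    rcases (hmP _ _ _).1 h1 with h | h
    · exact haP' h.2
    · exact hs₂.2.2.1 h.1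

end Backward

end GammaGraph

theorem mainTheorem11 {V : Type u} [Fintype V] [DecidableEq V] (T : SimpleGraph V)
    (hT : T.IsTree) (S : {D : Finset V // GammaGraph.IsGammaSet T D})
    (hS : GammaGraph.IsStem (GammaGraph.gammaGraph T) S)
    (hdeg : 3 ≤ ((GammaGraph.deleteLeavesAt (GammaGraph.gammaGraph T) S).neighborSet
      ⟨S, GammaGraph.self_mem_compl_leavesAt (GammaGraph.gammaGraph T) S⟩).ncard) :
    GammaGraph.IsCartesianProductGraph
        (GammaGraph.deleteLeavesAt (GammaGraph.gammaGraph T) S) ↔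
      ∀ x ∈ S.1, ∃ y, GammaGraph.IsExternalPrivateNbr T S.1 x y :=
  ⟨GammaGraph.exists_external_of_isCartesianProductGraph hT S hS hdeg,
    GammaGraph.isCartesianProductGraph_of_external hT hS hdeg⟩
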